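/- Conventions. Let $X$ be a compact metric space and $\phi\colon\mathbb R\times X\to X$ a continuous flow. - $\phi$ is kinematic expansive if for every $\epsilon>0$ there is $\delta>0$ such that, whenever $\operatorname{dist}(\phi_t(x),\phi_t(y))<\delta$ for all $t\in\mathbb R$, there is $s\in\mathbb R$ with $|s|<\epsilon$ and $y=\phi_s(x)$. - A set $S\subset X$ is a local cross section through $x\in S$ if $S$ is closed and there is $\zeta>0$ such that $(t,y)\mapsto\phi_t(y)$ maps $[-\zeta,\zeta]\times S$ injectively onto a neighbourhood of $x$ in $X$. - A compact set $L\subset X$ is a global section of $\phi$ if every $x\in L$ has a neighbourhood $U$ such that $U\cap L$ is a local cross section through $x$, and every orbit of $\phi$ meets $L$. - A flow $\phi$ without singularities (points fixed by all $\phi_t$) is a suspension of a map $f\colon l\to l$ if, up to identifying $l$ with a subset of $X$ by a topological embedding, $l$ is a global section of $\phi$ and $f$ is its first return map: for every $x\in l$ there is $t>0$ with $f(x)=\phi_t(x)$ and $\phi_{(0,t]}(x)\cap l=\{f(x)\}$. - The map $f$ admits a kinematic expansive suspension if there are a compact metric space $X$ and a kinematic expansive continuous flow without singularities on $X$ that is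 a suspension of $f$. Theorem. Let $l$ be a compact metric space. The following statements are equivalent: 1. the identity map of $l$ admits a kinematic expansive suspension; 2. there is a continuous map $T\colon l\to\mathbb R$ that is locally injective, i.e. there is $\delta>0$ such that $T(x)\neq T(y)$ whenever $0<\operatorname{dist}(x,y)<\delta$; 3. $l$ is homeomorphic to a subset of $\mathbb R$. -/

import Mathlib

open Set Topology

namespace KinematicFlows

/-- A continuous flow on a metric space is kinematic expansive if for all `ε > 0` there is `δ > 0`
such that two points whose orbits stay `δ`-close at all times lie on a common orbit segment of
time less than `ε`. -/
def IsKinematicExpansive {X : Type*} [MetricSpace X] (φ : Flow ℝ X) : Prop :=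
  ∀ ε > 0, ∃ δ > 0, ∀ x y : X, (∀ t : ℝ, dist (φ t x) (φ t y) < δ) →
    ∃ s : ℝ, |s| < ε ∧ y = φ s x

/-- The flow has no singularities: no point is fixed by all times. -/
def HasNoSingularities {X : Type*} [TopologicalSpace X] (φ : Flow ℝ X) : Prop :=
  ∀ x : X, ∃ t : ℝ, φ t x ≠ x

/-- `S` is a local cross section through `x` (in the sense of Whitney): `S` is closed, contains
`x`, and for some `ζ > 0` the flow maps `[-ζ, ζ] × S` injectively (hence, in a compact space,
homeomorphically) onto a neighbourhood of `x`. -/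
def IsLocalCrossSection {X : Type*} [TopologicalSpace X] (φ : Flow ℝ X) (S : Set X) (x : X) :
    Prop :=
  IsClosed S ∧ x ∈ S ∧ ∃ ζ : ℝ, 0 < ζ ∧
    InjOn (fun p : ℝ × X => φ p.1 p.2) (Icc (-ζ) ζ ×ˢ S) ∧
    (fun p : ℝ × X => φ p.1 p.2) '' (Icc (-ζ) ζ ×ˢ S) ∈ 𝓝 x

/-- A global section: a compact set that is near each of its points a local cross section, and
that is cut by every orbit. -/
def IsGlobalSection {X : Type*} [TopologicalSpace X] (φ : Flow ℝ X) (L : Set X) : Prop :=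
  IsCompact L ∧ (∀ x ∈ L, ∃ U ∈ 𝓝 x, IsLocalCrossSection φ (U ∩ L) x) ∧
    ∀ x : X, ∃ t : ℝ, φ t x ∈ L

/-- `φ` is a suspension of `f : l → l`, where `l` is identified through the topological embedding
`i` with a global section of `φ` and `f` with the first return map to this section: for each `x`
there is `t > 0` with `f x = φ_t x` and `φ_{(0, t]} x ∩ l = {f x}`. -/
def IsSuspension {l X : Type*} [TopologicalSpace l] [TopologicalSpace X] (φ : Flow ℝ X)
    (f : l → l) (i : l → X) : Prop :=
  HasNoSingularities φ ∧ IsEmbedding i ∧ IsGlobalSection φ (range i) ∧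
    ∀ x : l, ∃ t : ℝ, 0 < t ∧ i (f x) = φ t (i x) ∧
      (fun s : ℝ => φ s (i x)) '' Ioc 0 t ∩ range i = {i (f x)}

/-- Some kinematic expansive flow on a compact metric space is a suspension of `f`. -/
def AdmitsKinematicExpansiveSuspension.{u} {l : Type u} [TopologicalSpace l] (f : l → l) : Prop :=
  ∃ (X : Type u) (_ : MetricSpace X) (_ : CompactSpace X) (φ : Flow ℝ X) (i : l → X),
    IsSuspension φ f i ∧ IsKinematicExpansive φ

end KinematicFlows

/-!
The proof goes around the equivalences between `(1)` and `(2)`, and between `(2)` and `(3)`.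

*A suspension of the identity gives a locally injective function.* All orbits are periodic, and
each meets the section once (`eq_of_mem_range_of_isSuspension_id`). The least period of a section
point depends continuously on it (`continuous_leastPeriod`). It is locally injective: two nearby
section points with the same period stay close during one period, hence forever, so kinematic
expansivity puts them on one orbit, which meets the section only once.

*A locally injective function gives a suspension of the identity.* On `l × ℝ/ℤ` let the circle over
`x` turn with speed `ω x`, where `ω ≥ 1` is a translate of the given function (`circleFlow`).
Circles over distinct nearby points have different speeds, and so some time separates any two points
on them by half a turn (`isKinematicExpansive_circleFlow`).

*A locally injective function gives an embedding in the line.* Such a function `T` is injective on a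
clopen neighbourhood of every point `p` (`exists_isClopen_injOn`). Indeed, there is a maximal closed
connected set `K` containing `p` on which `T` is injective. By compactness `T` is still injective on
a closed neighbourhood `W` of `K`, and by maximality `K` is a component of `W`; since components of
compact Hausdorff spaces are intersections of clopen sets, `K` has a clopen neighbourhood inside
the interior of `W`. Finitely many such clopen sets cover `l`, and their images can be moved apart
(`exists_continuous_injective`). The converse implication is immediate.
-/

open Set Topology

namespace KinematicFlows

/-! ### The period function of a suspension of the identity -/

section Period

/-- The least positive period of the point `x` under the flow. It is the infimum of the positive
periods, so it has the value `0` if there are none. -/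
noncomputable def leastPeriod {X : Type*} [TopologicalSpace X] (φ : Flow ℝ X) (x : X) : ℝ :=
  sInf {t | 0 < t ∧ φ t x = x}

theorem periodic_flow {X : Type*} [TopologicalSpace X] {φ : Flow ℝ X} {x : X} {t : ℝ}
    (h : φ t x = x) : Function.Periodic (fun s => φ s x) t := fun s => by
  simp only [φ.map_add, h]

theorem isLeast_leastPeriod {X : Type*} [TopologicalSpace X] [T2Space X] {φ : Flow ℝ X} {x : X}
    (hne : ∃ t, 0 < t ∧ φ t x = x) {c : ℝ} (hc : 0 < c)
    (h : ∀ t, 0 < t → φ t x = x → c ≤ t) :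
    IsLeast {t | 0 < t ∧ φ t x = x} (leastPeriod φ x) := by
  have hset : {t | 0 < t ∧ φ t x = x} = {t | c ≤ t} ∩ {t | φ t x = x} := by
    ext t
    exact ⟨fun ht => ⟨h t ht.1 ht.2, ht.2⟩, fun ht => ⟨hc.trans_le ht.1, ht.2⟩⟩
  have hbdd : BddBelow {t | 0 < t ∧ φ t x = x} := ⟨0, fun t ht => ht.1.le⟩
  refine ⟨IsClosed.csInf_mem ?_ hne hbdd, fun t ht => csInf_le hbdd ht⟩
  rw [hset]
  exact (isClosed_le continuous_const continuous_id).inter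
    (isClosed_eq (φ.continuous continuous_id continuous_const) continuous_const)

/-- For a suspension of the identity, each orbit meets the section only once. -/
theorem eq_of_mem_range_of_isSuspension_id {l X : Type*} [TopologicalSpace l] [TopologicalSpace X]
    {φ : Flow ℝ X} {i : l → X} (h : IsSuspension φ id i) {x : l} {s : ℝ}
    (hs : φ s (i x) ∈ range i) : φ s (i x) = i x := by
  obtain ⟨t, ht, hper, hret⟩ := h.2.2.2 x
  obtain ⟨u, hu, hsu⟩ := (periodic_flow (φ := φ) hper.symm).exists_mem_Ioc ht s 0
  rw [zero_add] at hu
  have hmem : φ s (i x) ∈ (fun s : ℝ => φ s (i x)) '' Ioc 0 t ∩ range i :=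
    ⟨⟨u, hu, hsu.symm⟩, hs⟩
  rwa [hret] at hmem

/-- A flow box of half-width `ζ` over `S` excludes periods up to `2 * ζ` for the points of `S`: such
a period `t` would give `φ (t / 2) x = φ (-(t / 2)) x`. -/
theorem two_mul_lt_of_injOn {X : Type*} [TopologicalSpace X] {φ : Flow ℝ X} {S : Set X} {ζ : ℝ}
    (h : InjOn (fun p : ℝ × X => φ p.1 p.2) (Icc (-ζ) ζ ×ˢ S)) {x : X} (hx : x ∈ S) {t : ℝ}
    (ht : 0 < t) (hper : φ t x = x) : 2 * ζ < t := by
  by_contra! hle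
  have heq : φ (t / 2) x = φ (-(t / 2)) x := by
    conv_rhs => rw [← hper, ← φ.map_add]
    congr 1
    ring
  have := h (x₁ := (t / 2, x)) (x₂ := (-(t / 2), x)) ⟨⟨by linarith, by linarith⟩, hx⟩
    ⟨⟨by linarith, by linarith⟩, hx⟩ heq
  linarith [(Prod.ext_iff.1 this).1]

theorem isLeast_leastPeriod_of_isSuspension_id {l X : Type*} [TopologicalSpace l]
    [TopologicalSpace X] [T2Space X] {φ : Flow ℝ X} {i : l → X} (h : IsSuspension φ id i) (x : l) :
    IsLeast {t | 0 < t ∧ φ t (i x) = i x} (leastPeriod φ (i x)) := by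
  obtain ⟨t, ht, hper, -⟩ := h.2.2.2 x
  obtain ⟨U, hU, -, hxU, ζ, hζ, hinj, -⟩ := h.2.2.1.2.1 (i x) ⟨x, rfl⟩
  exact isLeast_leastPeriod ⟨t, ht, hper.symm⟩ (c := 2 * ζ) (by positivity)
    fun s hs hs' => (two_mul_lt_of_injOn hinj hxU hs hs').le

/-- Write `τ y` for the least period of `i y`. In a flow box of half-width `ζ` around `i x`, the
orbit of `i y`, for `y` near `x`, is back in the box at time `τ x`, which puts the period `τ y`
between `2 * ζ` and `τ x + ζ < 2 * τ x`. Cluster values of `τ` at `x` are periods of `i x` in this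
range, and `τ x` is the only one. -/
theorem continuous_leastPeriod {l X : Type*} [TopologicalSpace l]
    [TopologicalSpace X] [T2Space X] {φ : Flow ℝ X} {i : l → X} (h : IsSuspension φ id i) :
    Continuous fun x => leastPeriod φ (i x) := by
  refine continuous_iff_continuousAt.2 fun x => ?_
  have hi : Continuous i := h.2.1.continuous
  have hleast := isLeast_leastPeriod_of_isSuspension_id h
  obtain ⟨U, hU, -, hxU, ζ, hζ, hinj, hnhds⟩ := h.2.2.1.2.1 (i x) ⟨x, rfl⟩
  set τ : l → ℝ := fun x => leastPeriod φ (i x) with hτ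
  have hx2 : 2 * ζ < τ x := two_mul_lt_of_injOn hinj hxU (hleast x).1.1 (hleast x).1.2
  have hmem : ∀ᶠ y in 𝓝 x, τ y ∈ Icc (2 * ζ) (τ x + ζ) := by
    have hcont : ContinuousAt (fun y => φ (τ x) (i y)) x := by fun_prop
    have hbox := hcont.eventually_mem (by rw [(hleast x).1.2]; exact hnhds)
    filter_upwards [hi.continuousAt.eventually_mem hU, hbox] with y hyU hy
    refine ⟨(two_mul_lt_of_injOn hinj ⟨hyU, y, rfl⟩ (hleast y).1.1 (hleast y).1.2).le, ?_⟩
    obtain ⟨⟨a, z⟩, ⟨ha, -, hz⟩, haz⟩ := hy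
    -- The orbit of `i y` passes through the section point `z` at time `τ x - a`; as it meets the
    -- section only in `i y`, this time is a period.
    simp only at ha hz haz
    have hφ : φ (τ x - a) (i y) = z := by
      rw [sub_eq_neg_add, φ.map_add, ← haz, ← φ.map_add, neg_add_cancel, φ.map_zero_apply]
    have hper : φ (τ x - a) (i y) = i y :=
      eq_of_mem_range_of_isSuspension_id h (by rwa [hφ])
    have := (hleast y).2 ⟨by linarith [ha.2], hper⟩
    linarith [ha.1]
  refine isCompact_Icc.tendsto_nhds_of_unique_mapClusterPt hmem fun T hT hclust => ?_
  obtain ⟨F, hF, hFT⟩ := mapClusterPt_iff_ultrafilter.1 hclust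
  have hix : Filter.Tendsto i F (𝓝 (i x)) := hi.continuousAt.mono_left hF
  -- A cluster value of the periods near `x` is a period of `i x`, and it is less than `2 * τ x`.
  have hper : φ T (i x) = i x := by
    have h1 : Filter.Tendsto (fun y => φ (τ y) (i y)) F (𝓝 (φ T (i x))) :=
      (φ.cont'.tendsto (T, i x)).comp (hFT.prodMk_nhds hix)
    have h2 : (fun y => φ (τ y) (i y)) = i := funext fun y => (hleast y).1.2
    rw [h2] at h1
    exact tendsto_nhds_unique h1 hix
  have hle : τ x ≤ T := (hleast x).2 ⟨by linarith [hT.1], hper⟩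
  by_contra hne
  have hlt : 0 < T - τ x := sub_pos.2 (lt_of_le_of_ne hle (Ne.symm hne))
  have hper' : φ (T - τ x) (i x) = i x := by
    have : φ (T - τ x + τ x) (i x) = φ (T - τ x) (i x) := periodic_flow (hleast x).1.2 _
    rw [sub_add_cancel, hper] at this
    exact this.symm
  have := (hleast x).2 ⟨hlt, hper'⟩
  linarith [hT.2]

theorem exists_locallyInjective_of_admitsKinematicExpansiveSuspension {l : Type*} [MetricSpace l]
    [CompactSpace l] (h : AdmitsKinematicExpansiveSuspension (id : l → l)) :
    ∃ T : l → ℝ, Continuous T ∧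
      ∃ δ : ℝ, 0 < δ ∧ ∀ x y : l, 0 < dist x y → dist x y < δ → T x ≠ T y := by
  obtain ⟨X, _, _, φ, i, hs, hexp⟩ := h
  have hleast := isLeast_leastPeriod_of_isSuspension_id hs
  have hcont := continuous_leastPeriod hs
  refine ⟨_, hcont, ?_⟩
  obtain ⟨δ', hδ', hexp⟩ := hexp 1 one_pos
  obtain ⟨M, hM⟩ := (isCompact_range hcont).bddAbove
  have hu : UniformContinuous fun p : Icc 0 M × l => φ p.1 (i p.2) :=
    CompactSpace.uniformContinuous_of_continuous
      (φ.continuous (by fun_prop) (hs.2.1.continuous.comp continuous_snd))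
  obtain ⟨δ, hδ, hu⟩ := Metric.uniformContinuous_iff.1 hu δ' hδ'
  refine ⟨δ, hδ, fun x y hpos hlt heq => ?_⟩
  -- Nearby section points with a common period stay close along one period, hence always.
  have hclose : ∀ t, dist (φ t (i x)) (φ t (i y)) < δ' := fun t => by
    have hp : Function.Periodic (fun s => (φ s (i x), φ s (i y))) (leastPeriod φ (i x)) :=
      fun s => Prod.ext (periodic_flow (hleast x).1.2 s)
        (by simpa only [heq] using periodic_flow (hleast y).1.2 s)
    obtain ⟨u, hu', htu⟩ := hp.exists_mem_Ioc (hleast x).1.1 t 0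
    rw [zero_add] at hu'
    simp only [Prod.mk.injEq] at htu
    rw [htu.1, htu.2]
    have huM : u ∈ Icc 0 M := ⟨hu'.1.le, hu'.2.trans (hM ⟨x, rfl⟩)⟩
    exact hu (a := (⟨u, huM⟩, x)) (b := (⟨u, huM⟩, y)) (by simpa [Prod.dist_eq] using hlt)
  obtain ⟨s, -, hsy⟩ := hexp _ _ hclose
  have hyx : i y = i x := by
    rw [hsy]
    exact eq_of_mem_range_of_isSuspension_id hs ⟨y, hsy⟩
  rw [hs.2.1.injective hyx, dist_self] at hpos
  exact hpos.false

end Period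

/-! ### The suspension with prescribed angular speeds -/

section CircleFlow

variable {l : Type*} [MetricSpace l]

/-- The flow on `l × ℝ/ℤ` that turns the circle over `x` with constant speed `ω x`. -/
def circleFlow (ω : l → ℝ) (hω : Continuous ω) : Flow ℝ (l × UnitAddCircle) where
  toFun t p := (p.1, p.2 + ((t * ω p.1 : ℝ) : UnitAddCircle))
  cont' := by
    refine Continuous.prodMk (by fun_prop) (Continuous.add (by fun_prop) ?_)
    exact (AddCircle.continuous_mk' 1).comp (by fun_prop)
  map_add' t₁ t₂ p := by
    refine Prod.ext rfl ?_
    simp only [add_mul, AddCircle.coe_add]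
    abel
  map_zero' p := by simp

@[simp]
theorem circleFlow_apply (ω : l → ℝ) (hω : Continuous ω) (t : ℝ) (p : l × UnitAddCircle) :
    circleFlow ω hω t p = (p.1, p.2 + ((t * ω p.1 : ℝ) : UnitAddCircle)) := rfl

/-- Every angle has a real representative of absolute value equal to its norm. -/
theorem exists_coe_eq_abs_eq_norm (θ : UnitAddCircle) :
    ∃ r : ℝ, (r : UnitAddCircle) = θ ∧ |r| = ‖θ‖ := by
  obtain ⟨x, rfl⟩ := QuotientAddGroup.mk_surjective θ
  refine ⟨x - round x, ?_, (UnitAddCircle.norm_eq (x := x)).symm⟩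
  rw [AddCircle.coe_sub, sub_eq_self, AddCircle.coe_eq_zero_iff]
  exact ⟨round x, by simp⟩

theorem eq_zero_of_coe_eq_zero_of_abs_lt_one {r : ℝ} (h : (r : UnitAddCircle) = 0)
    (hr : |r| < 1) : r = 0 := by
  obtain ⟨n, hn⟩ := (AddCircle.coe_eq_zero_iff (1 : ℝ)).1 h
  rw [zsmul_one] at hn
  rw [← hn] at hr ⊢
  have : |n| < 1 := by exact_mod_cast hr
  rw [Int.abs_lt_one_iff.1 this, Int.cast_zero]

theorem mem_range_prodMk_zero {l : Type*} {p : l × UnitAddCircle} :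
    p ∈ range (fun x : l => (x, (0 : UnitAddCircle))) ↔ p.2 = 0 :=
  ⟨by rintro ⟨x, rfl⟩; rfl, fun h => ⟨p.1, Prod.ext rfl h.symm⟩⟩

/-- The zero section is a global section, with return time `1 / ω x` at `x`. The speeds are taken to
be at least `1` so that an angle `r` is swept in time at most `|r|`. -/
theorem isSuspension_circleFlow [CompactSpace l] {ω : l → ℝ} (hω : Continuous ω)
    (hω1 : ∀ x, 1 ≤ ω x) :
    IsSuspension (circleFlow ω hω) (id : l → l) fun x => (x, (0 : UnitAddCircle)) := by
  have hpos : ∀ x, 0 < ω x := fun x => zero_lt_one.trans_le (hω1 x)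
  have hL : IsCompact (range fun x : l => (x, (0 : UnitAddCircle))) :=
    isCompact_range (by fun_prop)
  refine ⟨fun p => ?_, isEmbedding_prodMkLeft _, ⟨hL, ?_, fun p => ?_⟩, fun x => ?_⟩
  · refine ⟨1 / 2 / ω p.1, fun h => ?_⟩
    have h2 := congrArg Prod.snd h
    simp only [circleFlow_apply, add_eq_left, div_mul_cancel₀ _ (hpos p.1).ne'] at h2
    have := eq_zero_of_coe_eq_zero_of_abs_lt_one h2 (by norm_num [abs_lt])
    norm_num at this
  · rintro _ ⟨x, rfl⟩
    refine ⟨univ, Filter.univ_mem, ?_⟩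
    rw [univ_inter]
    obtain ⟨M, hM⟩ := (isCompact_range hω).bddAbove
    have hM : ∀ y, ω y ≤ M := fun y => hM ⟨y, rfl⟩
    have hM0 : 0 < M := (hpos x).trans_le (hM x)
    -- At speed at most `M`, a time window of length `2 * ζ` covers at most half a turn.
    have hζ : 0 < 1 / (4 * M) := by positivity
    refine ⟨hL.isClosed, ⟨x, rfl⟩, 1 / (4 * M), hζ, ?_, ?_⟩
    · rintro ⟨t, _⟩ ⟨ht, y, rfl⟩ ⟨s, _⟩ ⟨hs, z, rfl⟩ h
      simp only [circleFlow_apply, Prod.mk.injEq, zero_add] at h ht hs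
      obtain ⟨rfl, h⟩ := h
      have h0 : (((t - s) * ω y : ℝ) : UnitAddCircle) = 0 := by
        rw [sub_mul, AddCircle.coe_sub, h, sub_self]
      have hts : |t - s| ≤ 1 / (2 * M) := by
        rw [abs_le]
        have : 1 / (2 * M) = 1 / (4 * M) + 1 / (4 * M) := by field_simp; norm_num
        constructor <;> linarith [ht.1, ht.2, hs.1, hs.2]
      have hlt : |(t - s) * ω y| < 1 := by
        rw [abs_mul, abs_of_pos (hpos y)]
        calc |t - s| * ω y ≤ 1 / (2 * M) * M :=
              mul_le_mul hts (hM y) (hpos y).le (by positivity)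
          _ < 1 := by field_simp; norm_num
      have := eq_zero_of_coe_eq_zero_of_abs_lt_one h0 hlt
      rcases mul_eq_zero.1 this with h | h
      · rw [sub_eq_zero.1 h]
      · exact absurd h (hpos y).ne'
    · have hnhds : {p : l × UnitAddCircle | ‖p.2‖ < 1 / (4 * M)} ∈ 𝓝 (x, (0 : UnitAddCircle)) :=
        (isOpen_lt (by fun_prop) continuous_const).mem_nhds (by simpa using hM0)
      refine Filter.mem_of_superset hnhds ?_
      rintro ⟨y, θ⟩ hθ
      obtain ⟨r, rfl, hr⟩ := exists_coe_eq_abs_eq_norm θ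
      simp only [mem_ofPred_eq, ← hr] at hθ
      refine ⟨(r / ω y, (y, 0)), ⟨?_, y, rfl⟩, ?_⟩
      · rw [mem_Icc, ← abs_le, abs_div, abs_of_pos (hpos y)]
        exact (div_le_self (abs_nonneg r) (hω1 y)).trans hθ.le
      · simp [div_mul_cancel₀ _ (hpos y).ne']
  · obtain ⟨r, hr, -⟩ := exists_coe_eq_abs_eq_norm p.2
    refine ⟨-r / ω p.1, mem_range_prodMk_zero.2 ?_⟩
    simp [div_mul_cancel₀ _ (hpos p.1).ne', ← hr]
  · have hone : (x, (0 : UnitAddCircle)) = circleFlow ω hω (1 / ω x) (x, 0) := by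
      simp [inv_mul_cancel₀ (hpos x).ne', AddCircle.coe_period]
    refine ⟨1 / ω x, by simpa using hpos x, hone, ?_⟩
    rw [eq_singleton_iff_unique_mem]
    refine ⟨⟨⟨1 / ω x, ⟨by simpa using hpos x, le_rfl⟩, hone.symm⟩, x, rfl⟩, ?_⟩
    rintro _ ⟨⟨s, -, rfl⟩, hs⟩
    exact Prod.ext rfl (mem_range_prodMk_zero.1 hs)

/-- Circles over distinct nearby points turn at different speeds, so their orbits get half a turn
apart at some time. -/
theorem isKinematicExpansive_circleFlow {ω : l → ℝ} (hω : Continuous ω) (hω1 : ∀ x, 1 ≤ ω x)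
    {δ : ℝ} (hδ : 0 < δ) (hinj : ∀ x y : l, 0 < dist x y → dist x y < δ → ω x ≠ ω y) :
    IsKinematicExpansive (circleFlow ω hω) := by
  intro ε hε
  refine ⟨min δ (min (1 / 2) ε), by positivity, ?_⟩
  rintro ⟨x, θ⟩ ⟨y, θ'⟩ h
  simp only [circleFlow_apply, Prod.dist_eq, max_lt_iff, lt_min_iff] at h
  have hxy : x = y := by
    by_contra hne
    have hsub : ω x - ω y ≠ 0 := sub_ne_zero.2 (hinj x y (dist_pos.2 hne) (h 0).1.1)
    obtain ⟨r, hr, -⟩ := exists_coe_eq_abs_eq_norm (θ - θ')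
    -- At this time the two angles are half a turn apart.
    obtain ⟨-, ⟨-, ht⟩, -⟩ := h ((1 / 2 - r) / (ω x - ω y))
    set t := (1 / 2 - r) / (ω x - ω y) with ht_def
    have hhalf : r + (t * ω x - t * ω y) = 1 / 2 := by
      rw [← mul_sub, ht_def, div_mul_cancel₀ _ hsub]; ring
    have : θ + ((t * ω x : ℝ) : UnitAddCircle) - (θ' + ((t * ω y : ℝ) : UnitAddCircle)) =
        ((1 / 2 : ℝ) : UnitAddCircle) := by
      rw [← hhalf, AddCircle.coe_add, AddCircle.coe_sub, hr]; abel
    rw [dist_eq_norm, this, AddCircle.norm_half_period_eq] at ht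
    norm_num at ht
  subst hxy
  obtain ⟨r, hr, hrn⟩ := exists_coe_eq_abs_eq_norm (θ' - θ)
  have hpos : 0 < ω x := zero_lt_one.trans_le (hω1 x)
  refine ⟨r / ω x, ?_, ?_⟩
  · have h0 := (h 0).2.2.2
    rw [dist_add_right, dist_comm, dist_eq_norm, ← hrn] at h0
    rw [abs_div, abs_of_pos hpos]
    exact (div_le_self (abs_nonneg r) (hω1 x)).trans_lt h0
  · simp [div_mul_cancel₀ _ hpos.ne', hr]

theorem admitsKinematicExpansiveSuspension_of_locallyInjective [CompactSpace l] {T : l → ℝ}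
    (hT : Continuous T) {δ : ℝ} (hδ : 0 < δ)
    (hinj : ∀ x y : l, 0 < dist x y → dist x y < δ → T x ≠ T y) :
    AdmitsKinematicExpansiveSuspension (id : l → l) := by
  obtain ⟨m, hm⟩ := (isCompact_range hT).bddBelow
  have hω : Continuous fun x => T x - m + 1 := by fun_prop
  have hω1 : ∀ x, 1 ≤ T x - m + 1 := fun x => by linarith [hm ⟨x, rfl⟩]
  exact ⟨l × UnitAddCircle, inferInstance, inferInstance, circleFlow _ hω, _,
    isSuspension_circleFlow hω hω1, isKinematicExpansive_circleFlow hω hω1 hδ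
      fun x y h0 h1 h => hinj x y h0 h1 (by linarith)⟩

end CircleFlow

/-! ### From local injectivity to an embedding in the line -/

section LocallyInjective

variable {l : Type*} [MetricSpace l] [CompactSpace l]

/-- If points at distance exactly `r` have values differing by at least `η`, then points of a closed
connected set on which `T` is injective (an arc or a point) whose values differ by less than `η`
are at distance less than `r`. The bound does not depend on the set. -/
theorem dist_lt_of_isPreconnected_of_injOn {T : l → ℝ} (hT : Continuous T) {r η : ℝ} (hr : 0 < r)
    (hη : ∀ x y : l, dist x y = r → η ≤ |T x - T y|) {K : Set l} (hKc : IsClosed K)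
    (hKp : IsPreconnected K) (hK : InjOn T K) {x y : l} (hx : x ∈ K) (hy : y ∈ K)
    (hxy : |T x - T y| < η) : dist x y < r := by
  have : CompactSpace K := isCompact_iff_compactSpace.1 hKc.isCompact
  have : PreconnectedSpace K := Subtype.preconnectedSpace hKp
  have hf : Continuous (K.domRestrict T) := hT.comp continuous_subtype_val
  have hrange : uIcc (T x) (T y) ⊆ range (K.domRestrict T) :=
    (isPreconnected_range hf).ordConnected.uIcc_subset ⟨⟨x, hx⟩, rfl⟩ ⟨⟨y, hy⟩, rfl⟩
  -- The part of `K` between the levels of `x` and `y` is an arc joining `x` to `y`.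
  have harc : IsPreconnected (K.domRestrict T ⁻¹' uIcc (T x) (T y)) :=
    isPreconnected_uIcc.preimage_of_isClosedMap (injOn_iff_injective.1 hK) hf.isClosedMap hrange
  have himg : IsPreconnected
      ((fun z : K => dist x z) '' (K.domRestrict T ⁻¹' uIcc (T x) (T y))) :=
    harc.image _ (by fun_prop)
  by_contra! hle
  obtain ⟨z, hz, hzr⟩ := himg.ordConnected.out
    ⟨⟨x, hx⟩, left_mem_uIcc, rfl⟩ ⟨⟨y, hy⟩, right_mem_uIcc, rfl⟩
    (show r ∈ Icc (dist x x) (dist x y) from ⟨by simpa using hr.le, hle⟩)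
  have h1 := hη x z hzr
  have h2 : |T z - T x| ≤ |T y - T x| := abs_sub_left_of_mem_uIcc hz
  rw [abs_sub_comm, abs_sub_comm (T y)] at h2
  linarith

/-- Zorn's lemma applies because the closure of the union of a chain is again admissible: by
`dist_lt_of_isPreconnected_of_injOn` two of its points with equal values are at distance at most
`δ / 2`, so they coincide by local injectivity. -/
theorem exists_maximal_injOn_isPreconnected {T : l → ℝ} (hT : Continuous T) {δ : ℝ} (hδ : 0 < δ)
    (hinj : ∀ x y : l, 0 < dist x y → dist x y < δ → T x ≠ T y) (p : l) :
    ∃ K : Set l, p ∈ K ∧ Maximal (fun K => IsClosed K ∧ IsPreconnected K ∧ InjOn T K) K := by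
  obtain ⟨η, hη0, hη⟩ : ∃ η, 0 < η ∧ ∀ q ∈ {q : l × l | dist q.1 q.2 = δ / 2},
      η ≤ |T q.1 - T q.2| := by
    refine IsCompact.exists_forall_le' (isClosed_eq (by fun_prop) (by fun_prop)).isCompact
      (by fun_prop) fun q hq => ?_
    simp only [mem_ofPred_eq] at hq
    exact abs_pos.2 (sub_ne_zero.2 (hinj _ _ (by linarith) (by linarith)))
  let 𝒦 : Set (Set l) := {K | IsClosed K ∧ IsPreconnected K ∧ InjOn T K}
  suffices hchains : ∀ c ⊆ 𝒦, IsChain (· ⊆ ·) c → c.Nonempty → ∃ ub ∈ 𝒦, ∀ s ∈ c, s ⊆ ub by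
    obtain ⟨K, hpK, hK⟩ := zorn_subset_nonempty 𝒦 hchains {p}
      ⟨isClosed_singleton, isPreconnected_singleton, injOn_singleton _ _⟩
    exact ⟨K, hpK rfl, hK⟩
  intro c hc hchain _
  refine ⟨closure (⋃₀ c), ⟨isClosed_closure, ?_, ?_⟩, fun s hs =>
    (subset_sUnion_of_mem hs).trans subset_closure⟩
  · exact (IsPreconnected.sUnion_directed hchain.directedOn fun s hs => (hc hs).2.1).closure
  · intro x hx y hy hxy
    by_contra hne
    have hlim : (x, y) ∈ closure ((⋃₀ c) ×ˢ (⋃₀ c)) := by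
      rw [closure_prod_eq]; exact ⟨hx, hy⟩
    have hopen : IsOpen {q : l × l | |T q.1 - T q.2| < η} :=
      isOpen_lt (by fun_prop) (by fun_prop)
    -- Approximating pairs from the union lie in a common member of the chain, which gives the
    -- uniform bound `δ / 2`.
    have hmem : (x, y) ∈ closure ({q : l × l | |T q.1 - T q.2| < η} ∩ (⋃₀ c) ×ˢ (⋃₀ c)) :=
      hopen.inter_closure ⟨by simpa [hxy] using hη0, hlim⟩
    have hcl : IsClosed {q : l × l | dist q.1 q.2 ≤ δ / 2} :=
      isClosed_le (by fun_prop) (by fun_prop)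
    have hsub : {q : l × l | |T q.1 - T q.2| < η} ∩ (⋃₀ c) ×ˢ (⋃₀ c) ⊆
        {q : l × l | dist q.1 q.2 ≤ δ / 2} := by
      rintro ⟨a, b⟩ ⟨hab, ⟨s, hs, ha⟩, ⟨t, ht, hb⟩⟩
      obtain ⟨K, hKc, hsK, htK⟩ := hchain.directedOn s hs t ht
      obtain ⟨hK1, hK2, hK3⟩ := hc hKc
      exact (dist_lt_of_isPreconnected_of_injOn hT (half_pos hδ) (fun u v huv => hη (u, v) huv)
        hK1 hK2 hK3 (hsK ha) (htK hb) hab).le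
    have := closure_minimal hsub hcl hmem
    simp only [mem_ofPred_eq] at this
    exact hinj x y (dist_pos.2 hne) (by linarith) hxy

/-- A maximal closed connected set `K` around `p` with `T` injective on it has a closed
neighbourhood `W` with the same injectivity, and maximality makes `K` a connected component of `W`. Hence some
subset of the interior of `W` that is clopen in `W` contains `p`, and it is clopen in `l`. -/
theorem exists_isClopen_injOn {T : l → ℝ} (hT : Continuous T) {δ : ℝ} (hδ : 0 < δ)
    (hinj : ∀ x y : l, 0 < dist x y → dist x y < δ → T x ≠ T y) (p : l) :
    ∃ E : Set l, IsClopen E ∧ p ∈ E ∧ InjOn T E := by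
  obtain ⟨K, hpK, ⟨hKc, hKp, hKi⟩, hmax⟩ := exists_maximal_injOn_isPreconnected hT hδ hinj p
  obtain ⟨V, hV, hVi⟩ := hKi.exists_mem_nhdsSet hKc.isCompact (fun x _ => hT.continuousAt)
    fun x _ => ⟨Metric.ball x (δ / 2), Metric.ball_mem_nhds x (half_pos hδ), fun a ha b hb hab => by
      by_contra hne
      refine hinj a b (dist_pos.2 hne) ?_ hab
      have := dist_triangle_right a b x
      rw [Metric.mem_ball] at ha hb
      linarith⟩
  obtain ⟨U, hUo, hKU, hUV⟩ := mem_nhdsSet_iff_exists.1 hV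
  obtain ⟨G, hGo, hKG, hGU⟩ := normal_exists_closure_subset hKc hUo hKU
  let W : Set l := closure G
  have hWi : InjOn T W := hVi.mono (hGU.trans hUV)
  have : CompactSpace W := isCompact_iff_compactSpace.1 isClosed_closure.isCompact
  let q : W := ⟨p, subset_closure (hKG hpK)⟩
  have hcomp : ((↑) : W → l) '' connectedComponent q ⊆ K := by
    have hK' : K ⊆ ((↑) : W → l) '' connectedComponent q := by
      have h1 : IsPreconnected (((↑) : W → l) ⁻¹' K) :=
        hKp.preimage_of_isClosedMap Subtype.val_injective
          isClosed_closure.isClosedEmbedding_subtypeVal.isClosedMap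
          (by simpa [W] using hKG.trans subset_closure)
      intro x hx
      exact ⟨⟨x, subset_closure (hKG hx)⟩, h1.subset_connectedComponent (x := q) hpK hx, rfl⟩
    refine hmax ⟨?_, ?_, ?_⟩ hK'
    · exact isClosed_closure.isClosedEmbedding_subtypeVal.isClosedMap _ isClosed_connectedComponent
    · exact isPreconnected_connectedComponent.image _ continuous_subtype_val.continuousOn
    · exact hWi.mono (by rintro _ ⟨x, -, rfl⟩; exact x.2)
  -- In the compact space `W` the component of `p` is the intersection of the clopen sets around
  -- it, so one of these already avoids the frontier of `W`.
  obtain ⟨⟨s, hs, hqs⟩, hsG⟩ :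
      ∃ s : {s : Set W // IsClopen s ∧ q ∈ s}, s.1 ⊆ ((↑) : W → l) ⁻¹' G := by
    have : Nonempty {s : Set W // IsClopen s ∧ q ∈ s} := ⟨⟨univ, isClopen_univ, mem_univ q⟩⟩
    refine exists_subset_nhds_of_compactSpace
      (V := fun s : {s : Set W // IsClopen s ∧ q ∈ s} => s.1) ?_ (fun s => s.2.1.1) fun y hy => ?_
    · rintro ⟨s, hs, hxs⟩ ⟨t, ht, hxt⟩
      exact ⟨⟨s ∩ t, hs.inter ht, ⟨hxs, hxt⟩⟩, inter_subset_left, inter_subset_right⟩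
    · rw [← connectedComponent_eq_iInter_isClopen] at hy
      exact (hGo.preimage continuous_subtype_val).mem_nhds (hKG (hcomp ⟨y, hy, rfl⟩))
  refine ⟨((↑) : W → l) '' s, ⟨?_, ?_⟩, ⟨q, hqs, rfl⟩,
    hWi.mono (by rintro _ ⟨x, -, rfl⟩; exact x.2)⟩
  · exact isClosed_closure.isClosedEmbedding_subtypeVal.isClosedMap _ hs.1
  · obtain ⟨O, hO, hOs⟩ := isOpen_induced_iff.1 hs.2
    have : ((↑) : W → l) '' s = O ∩ G := by
      subst hOs
      ext x
      constructor
      · rintro ⟨y, hy, rfl⟩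
        exact ⟨hy, hsG hy⟩
      · rintro ⟨hx1, hx2⟩
        exact ⟨⟨x, subset_closure hx2⟩, hx1, rfl⟩
    rw [this]
    exact hO.inter hGo

/-- Finitely many clopen sets on which `T` is injective cover `l`, and translations make the images
of the corresponding pieces disjoint. -/
theorem exists_continuous_injective {T : l → ℝ} (hT : Continuous T)
    (h : ∀ p : l, ∃ E : Set l, IsClopen E ∧ p ∈ E ∧ InjOn T E) :
    ∃ F : l → ℝ, Continuous F ∧ F.Injective := by
  suffices h : ∃ E : Set l, IsClopen E ∧ univ ⊆ E ∧ ∃ F : l → ℝ, Continuous F ∧ InjOn F E by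
    obtain ⟨E, -, hE, F, hF, hFi⟩ := h
    exact ⟨F, hF, injOn_univ.1 (hFi.mono hE)⟩
  refine isCompact_univ.induction_on
    (p := fun s => ∃ E : Set l, IsClopen E ∧ s ⊆ E ∧ ∃ F : l → ℝ, Continuous F ∧ InjOn F E)
    ⟨∅, isClopen_empty, subset_rfl, T, hT, injOn_empty _⟩ ?_ ?_ ?_
  · rintro s t hst ⟨E, hE, htE, hF⟩
    exact ⟨E, hE, hst.trans htE, hF⟩
  · rintro s t ⟨E, hE, hsE, F, hF, hFi⟩ ⟨E', hE', htE, F', hF', hFi'⟩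
    classical
    obtain ⟨M, hM⟩ := (isCompact_range hF).bddAbove
    obtain ⟨m, hm⟩ := (isCompact_range hF').bddBelow
    -- The constant shifts the values of `F'` above those of `F`.
    have hlt : ∀ x y : l, F x < F' y + (M - m + 1) := fun x y => by
      have h1 := hM ⟨x, rfl⟩
      have h2 := hm ⟨y, rfl⟩
      linarith
    refine ⟨E ∪ E', hE.union hE', union_subset_union hsE htE,
      E.piecewise F fun y => F' y + (M - m + 1), ?_, ?_⟩
    · refine hF.piecewise (fun x hx => ?_) (by fun_prop)
      rw [hE.frontier_eq] at hx
      exact hx.elim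
    · intro x hx y hy hxy
      by_cases hxE : x ∈ E <;> by_cases hyE : y ∈ E <;> simp only [hxE, hyE, piecewise_eq_of_mem,
        piecewise_eq_of_notMem, not_false_eq_true] at hxy
      · exact hFi hxE hyE hxy
      · exact absurd hxy (hlt x y).ne
      · exact absurd hxy (hlt y x).ne'
      · exact hFi' (hx.resolve_left hxE) (hy.resolve_left hyE) (add_right_cancel hxy)
  · intro p _
    obtain ⟨E, hE, hpE, hEi⟩ := h p
    exact ⟨E, mem_nhdsWithin_of_mem_nhds (hE.2.mem_nhds hpE), E, hE, subset_rfl, T, hT, hEi⟩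

end LocallyInjective

end KinematicFlows

theorem mainTheorem5 (l : Type*) [MetricSpace l] [CompactSpace l] :
    List.TFAE
      [KinematicFlows.AdmitsKinematicExpansiveSuspension (id : l → l),
       ∃ T : l → ℝ, Continuous T ∧
         ∃ δ : ℝ, 0 < δ ∧ ∀ x y : l, 0 < dist x y → dist x y < δ → T x ≠ T y,
       ∃ s : Set ℝ, Nonempty (l ≃ₜ s)] := by
  tfae_have 1 → 2 :=
    KinematicFlows.exists_locallyInjective_of_admitsKinematicExpansiveSuspension
  tfae_have 2 → 1 := fun ⟨_, hT, _, hδ, hinj⟩ =>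
    KinematicFlows.admitsKinematicExpansiveSuspension_of_locallyInjective hT hδ hinj
  tfae_have 2 → 3 := by
    rintro ⟨T, hT, δ, hδ, hinj⟩
    obtain ⟨F, hF, hFi⟩ := KinematicFlows.exists_continuous_injective hT
      (KinematicFlows.exists_isClopen_injOn hT hδ hinj)
    exact ⟨Set.range F, ⟨(hF.isClosedEmbedding hFi).isEmbedding.toHomeomorph⟩⟩
  tfae_have 3 → 2 := fun ⟨_, ⟨e⟩⟩ =>
    ⟨fun x => e x, continuous_subtype_val.comp e.continuous, 1, one_pos, fun _ _ hpos _ heq =>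
      dist_pos.1 hpos (e.injective (Subtype.ext heq))⟩
  tfae_finish
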